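/- Let $(V,\mu)$ be a separable probability space. A kernel $M\in L^2(V\times V,\mu\times\mu)$ (complex valued) acts on the complex Hilbert space $L^2(V,\mu)$ by $(Mf)(x)=\int_V M(x,y)f(y)\,d\mu(y)$; its eigenvalues, its rank $\mathrm{rk}(M)$ (the dimension of its range) and self-adjointness refer to this operator. The cut norm of $M$ is $$\|M\|_\square=\sup_{\|f\|_\infty\le 1,\ \|g\|_\infty\le 1}\Bigl|\int_V\overline{f(x)}\,(Mg)(x)\,d\mu(x)\Bigr| ,$$ with $f,g$ ranging over measurable functions $V\to\mathbb{C}$. For a self-adjoint kernel $M$ and $\lambda>0$ put $$[M]_\lambda=\sum_{\tau\in\mathbb{R},\ |\tau|>\lambda}\tau P_\tau ,$$ where $P_\tau$ is (the kernel of) the orthogonal projection of $L^2(V,\mu)$ onto the eigenspace $W_\tau=\{f : Mf=\tau f\}$ (only finitely many terms are nonzero, each of finite rank). Lemma. Let $(M_i)_{i\ge 1}$ be a sequence of self-adjoint kernels in $L^2(V\times V)$ with $\|M_i\|_\infty\le 1$ for all $i$, and let $M\in L^2(V\times V)$ be its limit in the cut norm, that is, $\|M_i-M\|_\square\to 0$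 ($M$ is then automatically self-adjoint). Let $\lambda>0$ be such that neither $\lambda$ nor $-\lambda$ is an eigenvalue of $M$. Then 1. $\lim_{i\to\infty}\mathrm{rk}([M_i]_\lambda)=\mathrm{rk}([M]_\lambda)$, and 2. $\lim_{i\to\infty}\bigl\|[M_i]_\lambda-[M]_\lambda\bigr\|_2=0$, where $\|\cdot\|_2$ is the norm of $L^2(V\times V)$. -/

import Mathlib

set_option linter.unusedSectionVars false

open MeasureTheory Filter Topology
open scoped ENNReal ComplexConjugate

noncomputable section

namespace HSKernel

variable {V : Type*} [MeasurableSpace V] {μ : Measure V} [IsProbabilityMeasure μ]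

/-- The function `x ↦ ∫ M(x, y) f(y) dμ(y)`. -/
def opFun (M : Lp ℂ 2 (μ.prod μ)) (f : Lp ℂ 2 μ) (x : V) : ℂ :=
  ∫ y, M (x, y) * f y ∂μ

theorem eLpNorm_two_sq {α : Type*} [MeasurableSpace α] (ν : Measure α) (f : α → ℂ) :
    eLpNorm f 2 ν ^ 2 = ∫⁻ a, ‖f a‖ₑ ^ 2 ∂ν := by
  rw [eLpNorm_eq_lintegral_rpow_enorm_toReal (by norm_num) (by norm_num),
    ← ENNReal.rpow_natCast, ← ENNReal.rpow_mul]
  simp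

theorem lintegral_slice (M : Lp ℂ 2 (μ.prod μ)) :
    ∫⁻ x, eLpNorm (fun y => M (x, y)) 2 μ ^ 2 ∂μ = eLpNorm M 2 (μ.prod μ) ^ 2 := by
  rw [eLpNorm_two_sq, lintegral_prod _
    ((Lp.stronglyMeasurable M).measurable.enorm.pow_const 2).aemeasurable]
  simp_rw [eLpNorm_two_sq]

theorem slice_stronglyMeasurable (M : Lp ℂ 2 (μ.prod μ)) (x : V) :
    StronglyMeasurable (fun y => M (x, y)) :=
  (Lp.stronglyMeasurable M).comp_measurable measurable_prodMk_left

theorem slice_memLp (M : Lp ℂ 2 (μ.prod μ)) :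
    ∀ᵐ x ∂μ, MemLp (fun y => M (x, y)) 2 μ := by
  have h1 : ∫⁻ x, eLpNorm (fun y => M (x, y)) 2 μ ^ 2 ∂μ ≠ ∞ := by
    rw [lintegral_slice]
    exact ENNReal.pow_ne_top (Lp.eLpNorm_ne_top M)
  have hm : Measurable fun x => eLpNorm (fun y => M (x, y)) 2 μ ^ 2 := by
    simp_rw [eLpNorm_two_sq]
    exact ((Lp.stronglyMeasurable M).measurable.enorm.pow_const 2).lintegral_prod_right'
  filter_upwards [ae_lt_top hm h1] with x hx
  refine ⟨(slice_stronglyMeasurable M x).aestronglyMeasurable, ?_⟩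
  by_contra h
  rw [not_lt, top_le_iff] at h
  simp [h] at hx

theorem integrable_slice_mul (M : Lp ℂ 2 (μ.prod μ)) (f : Lp ℂ 2 μ) :
    ∀ᵐ x ∂μ, Integrable (fun y => M (x, y) * f y) μ := by
  filter_upwards [slice_memLp M] with x hx
  exact hx.integrable_mul (Lp.memLp f)

theorem enorm_opFun_le (M : Lp ℂ 2 (μ.prod μ)) (f : Lp ℂ 2 μ) (x : V) :
    ‖opFun M f x‖ₑ ≤ eLpNorm (fun y => M (x, y)) 2 μ * eLpNorm f 2 μ := by
  calc ‖opFun M f x‖ₑ ≤ ∫⁻ y, ‖M (x, y) * f y‖ₑ ∂μ := enorm_integral_le_lintegral_enorm _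
    _ = eLpNorm ((fun y => M (x, y)) • (f : V → ℂ)) 1 μ := by
        rw [eLpNorm_one_eq_lintegral_enorm]; rfl
    _ ≤ _ := eLpNorm_smul_le_mul_eLpNorm (Lp.stronglyMeasurable f).aestronglyMeasurable
        (slice_stronglyMeasurable M x).aestronglyMeasurable

theorem opFun_stronglyMeasurable (M : Lp ℂ 2 (μ.prod μ)) (f : Lp ℂ 2 μ) :
    StronglyMeasurable (opFun M f) := by
  have h : StronglyMeasurable (fun p : V × V => M p * f p.2) :=
    (Lp.stronglyMeasurable M).mul ((Lp.stronglyMeasurable f).comp_measurable measurable_snd)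
  exact h.integral_prod_right'

theorem eLpNorm_opFun_le (M : Lp ℂ 2 (μ.prod μ)) (f : Lp ℂ 2 μ) :
    eLpNorm (opFun M f) 2 μ ≤ eLpNorm M 2 (μ.prod μ) * eLpNorm f 2 μ := by
  rw [← ENNReal.pow_le_pow_left_iff (n := 2) (by norm_num), mul_pow, eLpNorm_two_sq,
    ← lintegral_slice M,
    ← lintegral_mul_const' _ _ (ENNReal.pow_ne_top (Lp.eLpNorm_ne_top f))]
  refine lintegral_mono fun x => ?_
  rw [← mul_pow]
  exact pow_le_pow_left' (enorm_opFun_le M f x) 2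

theorem opFun_memLp (M : Lp ℂ 2 (μ.prod μ)) (f : Lp ℂ 2 μ) : MemLp (opFun M f) 2 μ :=
  ⟨(opFun_stronglyMeasurable M f).aestronglyMeasurable, (eLpNorm_opFun_le M f).trans_lt
    (ENNReal.mul_lt_top (Lp.eLpNorm_lt_top M) (Lp.eLpNorm_lt_top f))⟩

/-- The bounded operator `f ↦ Mf`, `Mf(x) = ∫ M(x, y) f(y) dμ(y)`, on `L²(V, μ)` given by a
Hilbert-Schmidt kernel `M ∈ L²(V × V, μ × μ)`. -/
def op (M : Lp ℂ 2 (μ.prod μ)) : Lp ℂ 2 μ →L[ℂ] Lp ℂ 2 μ :=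
  LinearMap.mkContinuous
    { toFun := fun f => (opFun_memLp M f).toLp
      map_add' := fun f g => by
        rw [← MemLp.toLp_add]
        refine MemLp.toLp_congr _ _ ?_
        filter_upwards [integrable_slice_mul M f, integrable_slice_mul M g] with x hf hg
        rw [Pi.add_apply, opFun, opFun, opFun, ← integral_add hf hg]
        refine integral_congr_ae ?_
        filter_upwards [Lp.coeFn_add f g] with y hy
        rw [hy, Pi.add_apply, mul_add]
      map_smul' := fun c f => by
        rw [RingHom.id_apply, ← MemLp.toLp_const_smul]
        refine MemLp.toLp_congr _ _ (Eventually.of_forall fun x => ?_)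
        rw [Pi.smul_apply, opFun, opFun, ← integral_smul]
        refine integral_congr_ae ?_
        filter_upwards [Lp.coeFn_smul c f] with y hy
        rw [hy, Pi.smul_apply, smul_eq_mul, smul_eq_mul, mul_left_comm] }
    ‖M‖ fun f => by
      simp only [LinearMap.coe_mk, AddHom.coe_mk, Lp.norm_toLp]
      rw [Lp.norm_def, Lp.norm_def, ← ENNReal.toReal_mul]
      exact ENNReal.toReal_mono
        (ENNReal.mul_ne_top (Lp.eLpNorm_ne_top M) (Lp.eLpNorm_ne_top f)) (eLpNorm_opFun_le M f)

theorem op_coeFn (M : Lp ℂ 2 (μ.prod μ)) (f : Lp ℂ 2 μ) :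
    op M f =ᵐ[μ] fun x => ∫ y, M (x, y) * f y ∂μ :=
  (opFun_memLp M f).coeFn_toLp

/-- The eigenspace `W_τ = {f ∈ L²(V, μ) | Mf = τ f}`. -/
def eigenspace (M : Lp ℂ 2 (μ.prod μ)) (τ : ℝ) : Submodule ℂ (Lp ℂ 2 μ) :=
  Module.End.eigenspace (op M : Module.End ℂ (Lp ℂ 2 μ)) (τ : ℂ)

/-- The real number `τ` is an eigenvalue of `M`. -/
def IsEigenvalue (M : Lp ℂ 2 (μ.prod μ)) (τ : ℝ) : Prop :=
  Module.End.HasEigenvalue (op M : Module.End ℂ (Lp ℂ 2 μ)) (τ : ℂ)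

/-- The cut norm `sup |f^* M g|`, over all `f, g` on `V` with `‖f‖_∞ ≤ 1`, `‖g‖_∞ ≤ 1`. -/
def cutNorm (M : Lp ℂ 2 (μ.prod μ)) : ℝ≥0∞ :=
  ⨆ (f : Lp ℂ 2 μ) (g : Lp ℂ 2 μ) (_ : eLpNorm f ∞ μ ≤ 1) (_ : eLpNorm g ∞ μ ≤ 1),
    ‖inner ℂ f (op M g)‖ₑ

/-- The rank of `M`: the dimension of its range. -/
def rank (M : Lp ℂ 2 (μ.prod μ)) : ℕ∞ :=
  Cardinal.toENat (Module.rank ℂ (LinearMap.range (op M : Lp ℂ 2 μ →ₗ[ℂ] Lp ℂ 2 μ)))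

theorem memLp_tensor (f g : Lp ℂ 2 μ) :
    MemLp (fun p : V × V => f p.1 * conj (g p.2)) 2 (μ.prod μ) := by
  have hf := Lp.stronglyMeasurable f
  have hg := Lp.stronglyMeasurable g
  have hm : StronglyMeasurable (fun p : V × V => f p.1 * conj (g p.2)) :=
    (hf.comp_measurable measurable_fst).mul
      (RCLike.continuous_conj.comp_stronglyMeasurable (hg.comp_measurable measurable_snd))
  refine ⟨hm.aestronglyMeasurable, ?_⟩
  have h : eLpNorm (fun p : V × V => f p.1 * conj (g p.2)) 2 (μ.prod μ) ^ 2
      = eLpNorm f 2 μ ^ 2 * eLpNorm g 2 μ ^ 2 := by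
    rw [eLpNorm_two_sq, eLpNorm_two_sq, eLpNorm_two_sq, ← lintegral_prod_mul
      (hf.measurable.enorm.pow_const 2).aemeasurable
      (hg.measurable.enorm.pow_const 2).aemeasurable]
    refine lintegral_congr fun p => ?_
    rw [enorm_mul, mul_pow, RCLike.enorm_conj]
  by_contra hc
  rw [not_lt, top_le_iff] at hc
  rw [hc] at h
  exact (ENNReal.mul_ne_top (ENNReal.pow_ne_top (Lp.eLpNorm_ne_top f))
    (ENNReal.pow_ne_top (Lp.eLpNorm_ne_top g))) (by rw [← h]; simp)

/-- The rank-one kernel `f g^*`, `(x, y) ↦ f(x) conj(g(y))`. -/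
def rankOne (f g : Lp ℂ 2 μ) : Lp ℂ 2 (μ.prod μ) := (memLp_tensor f g).toLp

theorem op_rankOne (f g h : Lp ℂ 2 μ) : op (rankOne f g) h = inner ℂ g h • f := by
  apply Lp.ext
  have h1 := Measure.ae_ae_of_ae_prod (memLp_tensor f g).coeFn_toLp
  filter_upwards [op_coeFn (rankOne f g) h, h1, Lp.coeFn_smul (inner ℂ g h) f] with x hx hx1 hx2
  rw [hx, hx2, Pi.smul_apply, smul_eq_mul, L2.inner_def, ← integral_mul_const]
  refine integral_congr_ae ?_
  filter_upwards [hx1] with y hy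
  rw [rankOne, hy, RCLike.inner_apply]
  ring

theorem inner_rankOne (f g : Lp ℂ 2 μ) (M : Lp ℂ 2 (μ.prod μ)) :
    inner ℂ (rankOne f g) M = inner ℂ f (op M g) := by
  have hint := L2.integrable_inner (𝕜 := ℂ) (rankOne f g) M
  rw [L2.inner_def, L2.inner_def, integral_prod _ hint]
  have h1 := Measure.ae_ae_of_ae_prod (memLp_tensor f g).coeFn_toLp
  refine integral_congr_ae ?_
  filter_upwards [op_coeFn M g, h1] with x hx hx1
  rw [hx, RCLike.inner_apply, ← integral_mul_const]
  refine integral_congr_ae ?_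
  filter_upwards [hx1] with y hy
  rw [rankOne, hy, RCLike.inner_apply, map_mul, RCLike.conj_conj]
  ring

theorem orthonormal_rankOne {ι : Type*} {e : ι → Lp ℂ 2 μ} (he : Orthonormal ℂ e) :
    Orthonormal ℂ fun i => rankOne (e i) (e i) := by
  classical
  rw [orthonormal_iff_ite] at he ⊢
  intro i j
  rw [inner_rankOne, op_rankOne, inner_smul_right, he, he]
  by_cases h : i = j
  · simp [h]
  · simp [h]

theorem op_eigenspace {M : Lp ℂ 2 (μ.prod μ)} {τ : ℝ} {f : Lp ℂ 2 μ}
    (hf : f ∈ eigenspace M τ) : op M f = (τ : ℂ) • f :=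
  Module.End.mem_eigenspace_iff.mp hf

/-- Orthonormal eigenvectors `e i` with eigenvalues `t i` satisfy `∑ (t i)² ≤ ‖M‖²`. -/
theorem sum_sq_le {ι : Type*} (s : Finset ι) (M : Lp ℂ 2 (μ.prod μ)) (e : ι → Lp ℂ 2 μ)
    (t : ι → ℝ) (he : Orthonormal ℂ e) (het : ∀ i, e i ∈ eigenspace M (t i)) :
    ∑ i ∈ s, t i ^ 2 ≤ ‖M‖ ^ 2 := by
  have h := (orthonormal_rankOne he).sum_inner_products_le M (s := s)
  refine le_trans (le_of_eq (Finset.sum_congr rfl fun i _ => ?_)) h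
  rw [inner_rankOne, op_eigenspace (het i), inner_smul_right, inner_self_eq_norm_sq_to_K, he.1 i]
  simp

/-- Eigenspaces of a Hilbert-Schmidt kernel for nonzero eigenvalues are finite-dimensional. -/
theorem finiteDimensional_eigenspace (M : Lp ℂ 2 (μ.prod μ)) {τ : ℝ} (hτ : τ ≠ 0) :
    FiniteDimensional ℂ (eigenspace M τ) := by
  by_contra hinf
  obtain ⟨n, hn⟩ := exists_nat_gt (‖M‖ ^ 2 / τ ^ 2)
  have hr : Cardinal.aleph0 ≤ Module.rank ℂ (eigenspace M τ) := by
    rw [← not_lt]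
    exact fun h => hinf (Module.rank_lt_aleph0_iff.mp h)
  obtain ⟨v, hv⟩ := Module.le_rank_iff_exists_linearMap.mp
    ((Cardinal.natCast_le_aleph0 (n := n)).trans hr)
  let w : (Fin n → ℂ) →ₗ[ℂ] Lp ℂ 2 μ := (eigenspace M τ).subtype ∘ₗ v
  have hw : Function.Injective w := (Submodule.subtype_injective _).comp hv
  have hfr : Module.finrank ℂ (LinearMap.range w) = n := by
    rw [LinearMap.finrank_range_of_inj hw, Module.finrank_fin_fun]
  let b := stdOrthonormalBasis ℂ (LinearMap.range w)
  have hb : Orthonormal ℂ fun i => (b i : Lp ℂ 2 μ) :=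
    b.orthonormal.comp_linearIsometry (LinearMap.range w).subtypeₗᵢ
  have hle := sum_sq_le Finset.univ M (fun i => (b i : Lp ℂ 2 μ)) (fun _ => τ) hb fun i => by
    obtain ⟨c, hc⟩ := (b i).2
    rw [← hc]
    exact (v c).2
  rw [Finset.sum_const, Finset.card_univ, Fintype.card_fin, hfr, nsmul_eq_mul] at hle
  rw [div_lt_iff₀ (by positivity)] at hn
  linarith

/-- A self-adjoint Hilbert-Schmidt kernel has finitely many eigenvalues outside `[-lam, lam]`. -/
theorem finite_eigenvalues (M : Lp ℂ 2 (μ.prod μ)) (hM : IsSelfAdjoint (op M)) {lam : ℝ}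
    (hlam : 0 < lam) : {τ : ℝ | lam < |τ| ∧ IsEigenvalue M τ}.Finite := by
  by_contra hinf
  obtain ⟨n, hn⟩ := exists_nat_gt (‖M‖ ^ 2 / lam ^ 2)
  obtain ⟨s, hs, hcard⟩ := Set.Infinite.exists_subset_card_eq hinf n
  have hex : ∀ τ : s, ∃ f : Lp ℂ 2 μ, f ∈ eigenspace M τ ∧ ‖f‖ = 1 := fun τ => by
    obtain ⟨f, hf, hf0⟩ := (hs τ.2).2.exists_hasEigenvector
    refine ⟨((‖f‖⁻¹ : ℝ) : ℂ) • f, Submodule.smul_mem _ _ hf, ?_⟩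
    rw [norm_smul, Complex.norm_real, norm_inv, norm_norm, inv_mul_cancel₀ (norm_ne_zero_iff.2 hf0)]
  choose e he he1 using hex
  have horth := (ContinuousLinearMap.isSelfAdjoint_iff_isSymmetric.mp
    hM).orthogonalFamily_eigenspaces
  have ho : Orthonormal ℂ e := by
    refine ⟨he1, fun i j hij => ?_⟩
    have hne : ((i : ℝ) : ℂ) ≠ ((j : ℝ) : ℂ) := fun h => hij (Subtype.ext (by exact_mod_cast h))
    exact horth hne ⟨e i, he i⟩ ⟨e j, he j⟩
  have hle := sum_sq_le Finset.univ M e (fun τ => (τ : ℝ)) ho he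
  have hge : (n : ℝ) * lam ^ 2 ≤ ∑ τ : s, (τ : ℝ) ^ 2 := by
    have := Finset.card_nsmul_le_sum (Finset.univ : Finset s) (fun τ => (τ : ℝ) ^ 2) (lam ^ 2)
      fun τ _ => by
        rw [← sq_abs (τ : ℝ)]
        exact pow_le_pow_left₀ hlam.le (hs τ.2).1.le 2
    rwa [Finset.card_univ, Fintype.card_coe, hcard, nsmul_eq_mul] at this
  rw [div_lt_iff₀ (by positivity)] at hn
  linarith

open Classical in
/-- The kernel of the orthogonal projection onto a finite-dimensional subspace `W` of `L²(V, μ)`: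
`∑ eⱼ eⱼ^*` over an orthonormal basis of `W`. (The value `0` for infinite-dimensional `W`, whose
projection has no Hilbert-Schmidt kernel, is a convention.) -/
def projKernel (W : Submodule ℂ (Lp ℂ 2 μ)) : Lp ℂ 2 (μ.prod μ) :=
  if _h : FiniteDimensional ℂ W then
    ∑ j, rankOne (stdOrthonormalBasis ℂ W j : Lp ℂ 2 μ) (stdOrthonormalBasis ℂ W j : Lp ℂ 2 μ)
  else 0

theorem op_add (M N : Lp ℂ 2 (μ.prod μ)) : op (M + N) = op M + op N := by
  ext1 f
  refine ext_inner_left ℂ fun g => ?_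
  rw [add_apply, inner_add_right, ← inner_rankOne, ← inner_rankOne,
    ← inner_rankOne, inner_add_right]

/-- `projKernel W` does represent the orthogonal projection onto `W`. -/
theorem op_projKernel (W : Submodule ℂ (Lp ℂ 2 μ)) [FiniteDimensional ℂ W] :
    op (projKernel W) = W.starProjection := by
  have hW : FiniteDimensional ℂ W := inferInstance
  have hsum : ∀ (s : Finset (Fin (Module.finrank ℂ W))) (k : _ → Lp ℂ 2 (μ.prod μ))
      (f : Lp ℂ 2 μ), op (∑ j ∈ s, k j) f = ∑ j ∈ s, op (k j) f := fun s k f => by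
    refine ext_inner_left ℂ fun g => ?_
    rw [← inner_rankOne, inner_sum, inner_sum]
    simp_rw [inner_rankOne]
  ext1 f
  rw [projKernel, dif_pos hW, hsum]
  simp_rw [op_rankOne]
  rw [Submodule.starProjection_apply,
    (stdOrthonormalBasis ℂ W).orthogonalProjectionOnto_apply_eq_sum f]
  simp

/-- The spectral truncation `[M]_lam = ∑_{|τ| > lam} τ P_τ` of a self-adjoint kernel `M`, where
`P_τ` is the orthogonal projection to the eigenspace `W_τ`. The sum runs over all real `τ` with
`|τ| > lam` (`P_τ = 0` unless `τ` is an eigenvalue) and is taken in `L²(V × V)`. -/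
def trunc (M : Lp ℂ 2 (μ.prod μ)) (lam : ℝ) : Lp ℂ 2 (μ.prod μ) :=
  ∑' τ : {τ : ℝ // lam < |τ|}, ((τ : ℝ) : ℂ) • projKernel (eigenspace M τ)

end HSKernel

end

/-! Two facts carry the proof: cut-norm convergence of uniformly bounded kernels is operator-norm
convergence, and spectral subspaces across a gap are stable under operator-norm perturbation.

For the first, cut `f` and `g` in the unit ball of `L²` at height `k`. The bounded parts cost `k²`
times the cut norm. The tails have `L¹` norm at most `1/k`, so they cost at most `2‖M‖_∞ / k`
(`enorm_op_le_cutNorm`). Applied to `M i - M j`, this gives a Cauchy sequence of operators. Its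
limit agrees with `op L` on bounded functions, hence everywhere (`tendsto_op_of_tendsto_cutNorm`).

For the second, these operators are compact and self-adjoint. Since `± lam` are not eigenvalues of
`L`, some `δ > 0` separates `lam` from the moduli of its eigenvalues (`exists_spectral_gap`). A
Davis–Kahan estimate (`norm_compl_starProjection_comp_le`) then bounds `(1 - P_W) P_U` and `(1 -
P_U) P_W` by `‖op (M i) - op L‖ / δ`, where `U` and `W` are the spectral subspaces of `M i` and `L`
above `lam`. So the dimensions agree eventually and the projections converge in norm.

The truncation acts as `op M` times the projection (`op_trunc`), so truncations converge in operator
norm. Their differences have bounded rank, where the operator norm controls the Hilbert–Schmidt norm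
(`norm_le_finrank_mul_norm_op`). -/

/-! ### Spans of eigenspaces of symmetric operators -/

section SpectralSubspace

variable {H : Type*} [NormedAddCommGroup H] [InnerProductSpace ℂ H]

/-- The algebraic span of the eigenspaces of `A` with eigenvalues in `S`. -/
def spectralSpan (A : H →L[ℂ] H) (S : Set ℂ) : Submodule ℂ H :=
  ⨆ z : S, Module.End.eigenspace (A : Module.End ℂ H) (z : ℂ)

theorem eigenspace_le_spectralSpan (A : H →L[ℂ] H) {S : Set ℂ} {z : ℂ} (hz : z ∈ S) :
    Module.End.eigenspace (A : Module.End ℂ H) z ≤ spectralSpan A S :=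
  le_iSup (fun z : S => Module.End.eigenspace (A : Module.End ℂ H) (z : ℂ)) ⟨z, hz⟩

theorem apply_mem_spectralSpan (A : H →L[ℂ] H) (S : Set ℂ) {f : H} (hf : f ∈ spectralSpan A S) :
    A f ∈ spectralSpan A S := by
  refine Submodule.iSup_induction _ (motive := fun f => A f ∈ spectralSpan A S) hf ?_ ?_ ?_
  · intro z f hf
    have h : A f = (z : ℂ) • f := Module.End.mem_eigenspace_iff.mp hf
    rw [h]
    exact Submodule.smul_mem _ _ (eigenspace_le_spectralSpan A z.2 hf)
  · simp
  · intro f g hf hg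
    rw [map_add]
    exact Submodule.add_mem _ hf hg

/-- Pythagoras, for `f` and for `A f`: eigenvectors for distinct eigenvalues are orthogonal, and `c
z` is the squared norm of the component of `f` at `z`. Bounds on `‖z‖` over `S` thus become bounds
on `‖A f‖`. -/
theorem exists_norm_sq_eq_of_mem_spectralSpan {A : H →L[ℂ] H}
    (hA : (A : H →ₗ[ℂ] H).IsSymmetric) {S : Set ℂ} {f : H} (hf : f ∈ spectralSpan A S) :
    ∃ (s : Finset S) (c : S → ℝ), (∀ z, 0 ≤ c z) ∧ ‖f‖ ^ 2 = ∑ z ∈ s, c z ∧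
      ‖A f‖ ^ 2 = ∑ z ∈ s, ‖(z : ℂ)‖ ^ 2 * c z := by
  classical
  obtain ⟨l, hl⟩ := (Submodule.mem_iSup_iff_exists_dfinsupp' _ f).mp hf
  have ho := hA.orthogonalFamily_eigenspaces.comp (Subtype.coe_injective (p := fun z => z ∈ S))
  refine ⟨l.support, fun z => ‖l z‖ ^ 2, fun z => sq_nonneg _, ?_, ?_⟩
  · rw [← hl, ← ho.norm_sum]
    rfl
  · have hAf : A f = ∑ z ∈ l.support, (((z : ℂ) • l z : _) : H) := by
      rw [← hl, DFinsupp.sum, map_sum]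
      exact Finset.sum_congr rfl fun z _ => Module.End.mem_eigenspace_iff.mp (l z).2
    have h := ho.norm_sum (fun z => (z : ℂ) • l z) l.support
    simp only [norm_smul, mul_pow] at h
    rw [hAf, ← h]
    rfl

theorem le_norm_apply_of_mem_spectralSpan {A : H →L[ℂ] H}
    (hA : (A : H →ₗ[ℂ] H).IsSymmetric) {S : Set ℂ} {a : ℝ} (ha : 0 ≤ a)
    (hS : ∀ z ∈ S, a ≤ ‖z‖) {f : H} (hf : f ∈ spectralSpan A S) : a * ‖f‖ ≤ ‖A f‖ := by
  obtain ⟨s, c, hc, h1, h2⟩ := exists_norm_sq_eq_of_mem_spectralSpan hA hf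
  refine le_of_sq_le_sq ?_ (norm_nonneg _)
  rw [mul_pow, h1, h2, Finset.mul_sum]
  exact Finset.sum_le_sum fun z _ =>
    mul_le_mul_of_nonneg_right (pow_le_pow_left₀ ha (hS z z.2) 2) (hc z)

theorem norm_apply_le_of_mem_spectralSpan {A : H →L[ℂ] H}
    (hA : (A : H →ₗ[ℂ] H).IsSymmetric) {S : Set ℂ} {b : ℝ} (hb : 0 ≤ b)
    (hS : ∀ z ∈ S, ‖z‖ ≤ b) {f : H} (hf : f ∈ spectralSpan A S) : ‖A f‖ ≤ b * ‖f‖ := by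
  obtain ⟨s, c, hc, h1, h2⟩ := exists_norm_sq_eq_of_mem_spectralSpan hA hf
  refine le_of_sq_le_sq ?_ (by positivity)
  rw [mul_pow, h1, h2, Finset.mul_sum]
  exact Finset.sum_le_sum fun z _ =>
    mul_le_mul_of_nonneg_right (pow_le_pow_left₀ (norm_nonneg _) (hS z z.2) 2) (hc z)

theorem spectralSpan_isOrtho {A : H →L[ℂ] H} (hA : (A : H →ₗ[ℂ] H).IsSymmetric) {S T : Set ℂ}
    (hST : Disjoint S T) : spectralSpan A S ⟂ spectralSpan A T := by
  refine Submodule.isOrtho_iSup_left.mpr fun z => Submodule.isOrtho_iSup_right.mpr fun w => ?_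
  exact hA.orthogonalFamily_eigenspaces.isOrtho (fun h => Set.disjoint_left.mp hST z.2 (h ▸ w.2))

theorem spectralSpan_union_compl (A : H →L[ℂ] H) (S : Set ℂ) :
    spectralSpan A S ⊔ spectralSpan A Sᶜ =
      ⨆ z : ℂ, Module.End.eigenspace (A : Module.End ℂ H) z := by
  apply le_antisymm
  · exact sup_le (iSup_le fun z => le_iSup_of_le (z : ℂ) le_rfl)
      (iSup_le fun z => le_iSup_of_le (z : ℂ) le_rfl)
  · refine iSup_le fun z => ?_
    by_cases hz : z ∈ S
    · exact le_sup_of_le_left (eigenspace_le_spectralSpan A hz)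
    · exact le_sup_of_le_right (eigenspace_le_spectralSpan A (S := Sᶜ) hz)

variable [CompleteSpace H]

/-- A compact self-adjoint operator has norm at most `b` on the orthogonal complement of its
eigenspaces with eigenvalues in `S`, if the complement of `S` lies in the ball of radius `b`. -/
theorem norm_apply_le_of_mem_orthogonal_spectralSpan {A : H →L[ℂ] H} (hA : IsSelfAdjoint A)
    (hc : IsCompactOperator A) {S : Set ℂ} [(spectralSpan A S).HasOrthogonalProjection]
    {b : ℝ} (hb : 0 ≤ b) (hS : ∀ z ∉ S, ‖z‖ ≤ b) {g : H} (hg : g ∈ (spectralSpan A S)ᗮ) :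
    ‖A g‖ ≤ b * ‖g‖ := by
  have hsym : (A : H →ₗ[ℂ] H).IsSymmetric :=
    ContinuousLinearMap.isSelfAdjoint_iff_isSymmetric.mp hA
  have hbot := ContinuousLinearMap.orthogonalComplement_iSup_eigenspaces_eq_bot (T := A) hc hsym
  rw [← spectralSpan_union_compl A S, ← Submodule.topologicalClosure_eq_top_iff] at hbot
  have hdense : Dense ((spectralSpan A S ⊔ spectralSpan A Sᶜ : Submodule ℂ H) : Set H) :=
    Submodule.dense_iff_topologicalClosure_eq_top.mpr hbot
  -- By the spectral theorem the eigenspaces span a dense subspace. Phrasing the bound for `f - P f`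
  -- with arbitrary `f` makes it a closed condition on all of `H`, so it need only be checked on
  -- that subspace.
  have hall : ∀ f : H, ‖A (f - (spectralSpan A S).starProjection f)‖ ≤
      b * ‖f - (spectralSpan A S).starProjection f‖ := by
    have hclosed : IsClosed {f : H | ‖A (f - (spectralSpan A S).starProjection f)‖ ≤
      b * ‖f - (spectralSpan A S).starProjection f‖} :=
      isClosed_le (by fun_prop) (by fun_prop)
    intro f
    refine hclosed.closure_subset_iff.mpr ?_ (hdense f)
    intro f hf
    obtain ⟨u, hu, s, hs, rfl⟩ := Submodule.mem_sup.mp hf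
    have hs' : s ∈ (spectralSpan A S)ᗮ :=
      (spectralSpan_isOrtho hsym (disjoint_compl_left (a := S))) hs
    have : (spectralSpan A S).starProjection (u + s) = u := by
      rw [map_add, Submodule.starProjection_eq_self_iff.mpr hu,
        (Submodule.starProjection_apply_eq_zero_iff _).mpr hs', add_zero]
    rw [Set.mem_ofPred_eq, this, add_sub_cancel_left]
    exact norm_apply_le_of_mem_spectralSpan hsym hb hS hs
  have h := hall g
  rwa [(Submodule.starProjection_apply_eq_zero_iff _).mpr hg, sub_zero] at h

end SpectralSubspace

/-! ### Perturbation of invariant subspaces -/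

section Perturbation

variable {H : Type*} [NormedAddCommGroup H] [InnerProductSpace ℂ H] [CompleteSpace H]

theorem IsSelfAdjoint.apply_mem_orthogonal {A : H →L[ℂ] H} (hA : IsSelfAdjoint A)
    {U : Submodule ℂ H} (hU : ∀ f ∈ U, A f ∈ U) {g : H} (hg : g ∈ Uᗮ) : A g ∈ Uᗮ := by
  intro f hf
  have hsym := ContinuousLinearMap.isSelfAdjoint_iff_isSymmetric.mp hA
  have h : inner ℂ (A f) g = inner ℂ f (A g) := hsym f g
  rw [← h]
  exact hg _ (hU f hf)

/-- The lower bound makes `A` injective on `U`, hence surjective by finite dimension. -/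
theorem exists_apply_eq_of_invariant {A : H →L[ℂ] H} {U : Submodule ℂ H} [FiniteDimensional ℂ U]
    (hU : ∀ f ∈ U, A f ∈ U) {a : ℝ} (ha : 0 < a) (hUa : ∀ f ∈ U, a * ‖f‖ ≤ ‖A f‖)
    {f : H} (hf : f ∈ U) : ∃ h ∈ U, A h = f := by
  have hinj : Function.Injective ((A : H →ₗ[ℂ] H).restrict hU) := by
    rw [← LinearMap.ker_eq_bot, LinearMap.ker_eq_bot']
    intro m hm
    have h0 : A m = 0 := congrArg Subtype.val hm
    have h1 := hUa m m.2
    rw [h0, norm_zero] at h1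
    have : ‖(m : H)‖ ≤ 0 := by
      by_contra hc
      have := mul_pos ha (not_le.mp hc)
      linarith
    exact Subtype.ext (norm_le_zero_iff.mp this)
  obtain ⟨h, hh⟩ := (LinearMap.injective_iff_surjective.mp hinj) ⟨f, hf⟩
  exact ⟨h, h.2, congrArg Subtype.val hh⟩

/-- If `A` is bounded below by `a` on the invariant subspace `U` and the self-adjoint operator `B`
is bounded by `b < a` on the orthogonal complement of the invariant subspace `W`, then `U` is
nearly contained in `W`, with an error controlled by `‖A - B‖ / (a - b)`. -/
theorem norm_compl_starProjection_comp_le {A B : H →L[ℂ] H} (hB : IsSelfAdjoint B)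
    {U W : Submodule ℂ H} [FiniteDimensional ℂ U] [W.HasOrthogonalProjection]
    (hU : ∀ f ∈ U, A f ∈ U) (hW : ∀ f ∈ W, B f ∈ W) {a b : ℝ} (hb : 0 ≤ b) (hab : b < a)
    (hUa : ∀ f ∈ U, a * ‖f‖ ≤ ‖A f‖) (hWb : ∀ g ∈ Wᗮ, ‖B g‖ ≤ b * ‖g‖) :
    ‖(1 - W.starProjection) * U.starProjection‖ ≤ ‖A - B‖ / (a - b) := by
  have ha : 0 < a := hb.trans_lt hab
  set X : H →L[ℂ] H := (1 - W.starProjection) * U.starProjection with hX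
  have hQ : ∀ f, f - W.starProjection f ∈ Wᗮ := fun f => W.sub_starProjection_mem_orthogonal f
  have hQn : ∀ f, ‖f - W.starProjection f‖ ≤ ‖f‖ := fun f => by
    have h1 : f - W.starProjection f = Wᗮ.starProjection f := by
      rw [Submodule.starProjection_orthogonal]; rfl
    rw [h1]
    exact Wᗮ.norm_starProjection_apply_le f
  have hXU : ∀ f ∈ U, X f = f - W.starProjection f := fun f hf => by
    simp [hX, Submodule.starProjection_eq_self_iff.mpr hf]
  -- `B` preserves both `W` and, being self-adjoint, its complement.
  have hcomm : ∀ f, W.starProjection (B f) = B (W.starProjection f) := fun f => by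
    have h1 : B f = B (W.starProjection f) + B (f - W.starProjection f) := by
      rw [← map_add, add_sub_cancel]
    rw [h1, map_add, Submodule.starProjection_eq_self_iff.mpr
      (hW _ (Submodule.starProjection_apply_mem _ _)),
      (Submodule.starProjection_apply_eq_zero_iff _).mpr
      (hB.apply_mem_orthogonal hW (hQ f)), add_zero]
  -- Write `f = A h` with `h ∈ U` and `‖h‖ ≤ ‖f‖ / a`. Then `X A h = (1 - P_W)(A - B) h + B X h`,
  -- and `X h` lies in the complement of `W`, where `B` is bounded by `b`.
  have key : ∀ f ∈ U, ‖X f‖ ≤ (‖A - B‖ + b * ‖X‖) / a * ‖f‖ := by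
    intro f hf
    obtain ⟨h, hh, rfl⟩ := exists_apply_eq_of_invariant hU ha hUa hf
    have h1 : X (A h) = ((A - B) h - W.starProjection ((A - B) h)) +
        B (h - W.starProjection h) := by
      rw [hXU _ hf, sub_apply, map_sub, map_sub, hcomm]
      abel
    have h2 : ‖X (A h)‖ ≤ (‖A - B‖ + b * ‖X‖) * ‖h‖ := by
      rw [h1, add_mul]
      refine (norm_add_le _ _).trans (add_le_add ((hQn _).trans ((A - B).le_opNorm h)) ?_)
      refine (hWb _ (hQ h)).trans ?_
      rw [← hXU h hh, mul_assoc]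
      exact mul_le_mul_of_nonneg_left (X.le_opNorm h) hb
    refine h2.trans ?_
    rw [div_mul_eq_mul_div, mul_div_assoc]
    refine mul_le_mul_of_nonneg_left ?_ (by positivity)
    rw [le_div_iff₀ ha, mul_comm]
    exact hUa h hh
  have hXn : ‖X‖ ≤ (‖A - B‖ + b * ‖X‖) / a := by
    refine X.opNorm_le_bound (by positivity) fun v => ?_
    have h1 : X v = X (U.starProjection v) := by
      rw [hXU _ (Submodule.starProjection_apply_mem _ _)]; rfl
    rw [h1]
    exact (key _ (Submodule.starProjection_apply_mem _ _)).trans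
      (mul_le_mul_of_nonneg_left (U.norm_starProjection_apply_le v) (by positivity))
  -- The bound is `a‖X‖ ≤ ‖A - B‖ + b‖X‖`, which can be solved for `‖X‖` because `b < a`.
  rw [le_div_iff₀ ha] at hXn
  rw [le_div_iff₀ (sub_pos.mpr hab)]
  linarith

/-- `P_U - P_W = (1 - P_W) P_U - P_W (1 - P_U)`, and the last product is the adjoint of `(1 - P_U)
P_W`. -/
theorem norm_starProjection_sub_le {U W : Submodule ℂ H} [U.HasOrthogonalProjection]
    [W.HasOrthogonalProjection] :
    ‖U.starProjection - W.starProjection‖ ≤ ‖(1 - W.starProjection) * U.starProjection‖ +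
      ‖(1 - U.starProjection) * W.starProjection‖ := by
  have h : U.starProjection - W.starProjection = (1 - W.starProjection) * U.starProjection -
      star ((1 - U.starProjection) * W.starProjection) := by
    rw [star_mul, star_sub, star_one, (isSelfAdjoint_starProjection U).star_eq,
      (isSelfAdjoint_starProjection W).star_eq]
    noncomm_ring
  rw [h]
  refine (norm_sub_le _ _).trans (by rw [norm_star])

/-- A vector of `U` killed by `P_W` is fixed by `(1 - P_W) P_U`, so it vanishes; thus `P_W` is
injective on `U`. -/
theorem finrank_le_of_norm_compl_starProjection_lt_one {U W : Submodule ℂ H}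
    [FiniteDimensional ℂ U] [FiniteDimensional ℂ W]
    (h : ‖(1 - W.starProjection) * U.starProjection‖ < 1) :
    Module.finrank ℂ U ≤ Module.finrank ℂ W := by
  let p : U →ₗ[ℂ] W := (W.orthogonalProjectionOnto : H →ₗ[ℂ] W) ∘ₗ U.subtype
  refine LinearMap.finrank_le_finrank_of_injective (f := p) ?_
  rw [← LinearMap.ker_eq_bot, LinearMap.ker_eq_bot']
  intro m hm
  have h0 : W.starProjection (m : H) = 0 := by
    rw [Submodule.starProjection_apply]
    exact congrArg Subtype.val hm
  have h1 := ((1 - W.starProjection) * U.starProjection).le_opNorm (m : H)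
  have h2 : ((1 - W.starProjection) * U.starProjection) (m : H) = m := by
    simp [Submodule.starProjection_eq_self_iff.mpr m.2, h0]
  rw [h2] at h1
  have : ‖(m : H)‖ ≤ 0 := by
    by_contra hc
    have := mul_lt_of_lt_one_left (not_le.mp hc) h
    linarith
  exact Subtype.ext (norm_le_zero_iff.mp this)

end Perturbation

/-- Only genuine eigenvalues contribute to the span, so a threshold may be moved freely inside a
spectral gap. -/
theorem spectralSpan_mono_of_hasEigenvalue {H : Type*} [NormedAddCommGroup H]
    [InnerProductSpace ℂ H] (A : H →L[ℂ] H) {S T : Set ℂ}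
    (h : ∀ z ∈ S, Module.End.HasEigenvalue (A : Module.End ℂ H) z → z ∈ T) :
    spectralSpan A S ≤ spectralSpan A T := by
  refine iSup_le fun z => ?_
  by_cases hz : Module.End.HasEigenvalue (A : Module.End ℂ H) z
  · exact eigenspace_le_spectralSpan A (h z z.2 hz)
  · rw [Module.End.hasEigenvalue_iff, not_not] at hz
    rw [hz]
    exact bot_le

theorem IsSelfAdjoint.eq_ofReal_of_hasEigenvalue {H : Type*} [NormedAddCommGroup H]
    [InnerProductSpace ℂ H] [CompleteSpace H] {A : H →L[ℂ] H} (hA : IsSelfAdjoint A) {z : ℂ}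
    (hz : Module.End.HasEigenvalue (A : Module.End ℂ H) z) : ((z.re : ℝ) : ℂ) = z :=
  Complex.conj_eq_iff_re.mp
    ((ContinuousLinearMap.isSelfAdjoint_iff_isSymmetric.mp hA).conj_eigenvalue_eq_self hz)

noncomputable section

namespace HSKernel

variable {V : Type*} [MeasurableSpace V] {μ : Measure V} [IsProbabilityMeasure μ]

/-! ### Linearity of kernels and their operators -/

theorem norm_op_le (M : Lp ℂ 2 (μ.prod μ)) : ‖op M‖ ≤ ‖M‖ :=
  LinearMap.mkContinuous_norm_le _ (norm_nonneg _) _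

theorem op_smul (c : ℂ) (M : Lp ℂ 2 (μ.prod μ)) : op (c • M) = c • op M := by
  ext1 f
  refine ext_inner_left ℂ fun g => ?_
  rw [smul_apply, inner_smul_right, ← inner_rankOne, ← inner_rankOne,
    inner_smul_right]

/-- The assignment of its operator to a kernel, as a bounded linear map. -/
def opCLM : Lp ℂ 2 (μ.prod μ) →L[ℂ] (Lp ℂ 2 μ →L[ℂ] Lp ℂ 2 μ) :=
  LinearMap.mkContinuous
    { toFun := op
      map_add' := op_add
      map_smul' := op_smul } 1 fun M => by
      rw [one_mul]
      exact norm_op_le M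

theorem opCLM_apply (M : Lp ℂ 2 (μ.prod μ)) : opCLM M = op M := rfl

theorem op_sub (M N : Lp ℂ 2 (μ.prod μ)) : op (M - N) = op M - op N :=
  map_sub opCLM M N

theorem op_sum {ι : Type*} (s : Finset ι) (K : ι → Lp ℂ 2 (μ.prod μ)) :
    op (∑ i ∈ s, K i) = ∑ i ∈ s, op (K i) :=
  map_sum opCLM K s

theorem rankOne_add_left (f f' g : Lp ℂ 2 μ) :
    rankOne (f + f') g = rankOne f g + rankOne f' g := by
  rw [rankOne, rankOne, rankOne, ← MemLp.toLp_add]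
  refine MemLp.toLp_congr _ _ ?_
  filter_upwards [Measure.quasiMeasurePreserving_fst.ae (Lp.coeFn_add f f')] with p hp
  rw [hp, Pi.add_apply, Pi.add_apply, add_mul]

theorem rankOne_add_right (f g g' : Lp ℂ 2 μ) :
    rankOne f (g + g') = rankOne f g + rankOne f g' := by
  rw [rankOne, rankOne, rankOne, ← MemLp.toLp_add]
  refine MemLp.toLp_congr _ _ ?_
  filter_upwards [Measure.quasiMeasurePreserving_snd.ae (Lp.coeFn_add g g')] with p hp
  rw [hp, Pi.add_apply, Pi.add_apply, map_add, mul_add]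

theorem rankOne_smul_left (c : ℂ) (f g : Lp ℂ 2 μ) :
    rankOne (c • f) g = c • rankOne f g := by
  rw [rankOne, rankOne, ← MemLp.toLp_const_smul]
  refine MemLp.toLp_congr _ _ ?_
  filter_upwards [Measure.quasiMeasurePreserving_fst.ae (Lp.coeFn_smul c f)] with p hp
  rw [hp, Pi.smul_apply, Pi.smul_apply, smul_eq_mul, smul_eq_mul, mul_assoc]

theorem rankOne_smul_right (c : ℂ) (f g : Lp ℂ 2 μ) :
    rankOne f (c • g) = conj c • rankOne f g := by
  rw [rankOne, rankOne, ← MemLp.toLp_const_smul]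
  refine MemLp.toLp_congr _ _ ?_
  filter_upwards [Measure.quasiMeasurePreserving_snd.ae (Lp.coeFn_smul c g)] with p hp
  rw [hp, Pi.smul_apply, Pi.smul_apply, smul_eq_mul, smul_eq_mul, map_mul, mul_left_comm]

/-- The sesquilinear map `(f, g) ↦ f g^*`. -/
def rankOneₗ : Lp ℂ 2 μ →ₗ[ℂ] Lp ℂ 2 μ →ₗ⋆[ℂ] Lp ℂ 2 (μ.prod μ) :=
  LinearMap.mk₂'ₛₗ (RingHom.id ℂ) (starRingEnd ℂ) rankOne rankOne_add_left rankOne_smul_left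
    rankOne_add_right rankOne_smul_right

theorem rankOneₗ_apply (f g : Lp ℂ 2 μ) : rankOneₗ f g = rankOne f g := rfl

/-! ### Hilbert–Schmidt norm against operator norm in finite rank -/

theorem norm_rankOne (f g : Lp ℂ 2 μ) : ‖rankOne f g‖ = ‖f‖ * ‖g‖ := by
  have h : ((‖rankOne f g‖ : ℂ)) ^ 2 = ((‖f‖ * ‖g‖ : ℝ) : ℂ) ^ 2 := by
    have h1 := inner_self_eq_norm_sq_to_K (𝕜 := ℂ) (rankOne f g)
    rw [inner_rankOne, op_rankOne, inner_smul_right, inner_self_eq_norm_sq_to_K,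
      inner_self_eq_norm_sq_to_K] at h1
    push_cast
    rw [mul_pow, mul_comm]
    exact h1.symm
  have h' : ‖rankOne f g‖ ^ 2 = (‖f‖ * ‖g‖) ^ 2 := by exact_mod_cast h
  exact (pow_left_inj₀ (norm_nonneg _) (by positivity) two_ne_zero).mp h'

/-- The span of the rank-one kernels `u v^*` with `u, v ∈ W`. -/
def tensorSpan (W : Submodule ℂ (Lp ℂ 2 μ)) : Submodule ℂ (Lp ℂ 2 (μ.prod μ)) :=
  Submodule.span ℂ {K | ∃ u ∈ W, ∃ v ∈ W, rankOne u v = K}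

theorem tensorSpan_mono {U W : Submodule ℂ (Lp ℂ 2 μ)} (h : U ≤ W) :
    tensorSpan U ≤ tensorSpan W :=
  Submodule.span_mono fun _ ⟨u, hu, v, hv, hK⟩ => ⟨u, h hu, v, h hv, hK⟩

/-- Both sides are linear in `K`, and for `K = u v^*` this is the expansion of `v` in the basis. It
recovers the kernel from finitely many values of its operator. -/
theorem eq_sum_rankOne_of_mem_tensorSpan {W : Submodule ℂ (Lp ℂ 2 μ)} {ι : Type*} [Fintype ι]
    (b : OrthonormalBasis ι ℂ W) {K : Lp ℂ 2 (μ.prod μ)} (hK : K ∈ tensorSpan W) :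
    K = ∑ i, rankOne (op K (b i)) (b i) := by
  induction hK using Submodule.span_induction with
  | mem K hK =>
    obtain ⟨u, hu, v, hv, rfl⟩ := hK
    simp_rw [op_rankOne, rankOne_smul_left]
    have hv' : v = ∑ i, inner ℂ (b i : Lp ℂ 2 μ) v • (b i : Lp ℂ 2 μ) := by
      have := congrArg Subtype.val (b.sum_repr' ⟨v, hv⟩)
      simpa using this.symm
    conv_lhs => rw [hv', ← rankOneₗ_apply, map_sum]
    refine Finset.sum_congr rfl fun i _ => ?_
    rw [rankOneₗ_apply, rankOne_smul_right, inner_conj_symm]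
  | zero =>
    rw [← opCLM_apply, map_zero]
    simp [← rankOneₗ_apply]
  | add K K' _ _ hK hK' =>
    conv_lhs => rw [hK, hK']
    simp_rw [op_add, add_apply, rankOne_add_left]
    rw [Finset.sum_add_distrib]
  | smul c K _ hK =>
    conv_lhs => rw [hK]
    simp_rw [op_smul, smul_apply, rankOne_smul_left]
    rw [Finset.smul_sum]

/-- On kernels supported by a finite-dimensional subspace, the Hilbert-Schmidt norm is controlled
by the operator norm. -/
theorem norm_le_finrank_mul_norm_op {W : Submodule ℂ (Lp ℂ 2 μ)} [FiniteDimensional ℂ W]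
    {K : Lp ℂ 2 (μ.prod μ)} (hK : K ∈ tensorSpan W) :
    ‖K‖ ≤ Module.finrank ℂ W * ‖op K‖ := by
  let b := stdOrthonormalBasis ℂ W
  rw [eq_sum_rankOne_of_mem_tensorSpan b hK]
  refine (norm_sum_le _ _).trans ?_
  -- The expansion also replaced `K` inside `op K` on the right; it is folded back there.
  rw [← eq_sum_rankOne_of_mem_tensorSpan b hK]
  refine (Finset.sum_le_card_nsmul _ _ ‖op K‖ fun i _ => ?_).trans (by simp)
  have hb : ‖(b i : Lp ℂ 2 μ)‖ = 1 := b.orthonormal.1 i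
  rw [norm_rankOne, hb, mul_one]
  simpa [hb] using (op K).le_opNorm (b i : Lp ℂ 2 μ)

/-! ### Compactness -/

theorem isCompactOperator_op_rankOne (f g : Lp ℂ 2 μ) : IsCompactOperator (op (rankOne f g)) := by
  have h : (op (rankOne f g) : Lp ℂ 2 μ → Lp ℂ 2 μ) =
      (ContinuousLinearMap.toSpanSingleton ℂ f) ∘ (innerSL ℂ g) := by
    ext1 h
    rw [op_rankOne]
    rfl
  rw [h]
  exact (isCompactOperator_of_locallyCompactSpace_dom (innerSL ℂ g)).clm_comp _

/-- Hilbert-Schmidt kernels act by compact operators. -/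
theorem isCompactOperator_op (M : Lp ℂ 2 (μ.prod μ)) : IsCompactOperator (op M) := by
  -- The kernels with compact operator form a closed subspace `C` containing every rank-one kernel.
  -- The component of `M` orthogonal to `C` therefore has vanishing matrix coefficients, so its
  -- operator is zero.
  let C : Submodule ℂ (Lp ℂ 2 (μ.prod μ)) :=
    (compactOperator (RingHom.id ℂ) (Lp ℂ 2 μ) (Lp ℂ 2 μ)).comap opCLM.toLinearMap
  have hC : IsClosed (C : Set (Lp ℂ 2 (μ.prod μ))) :=
    (isClosed_setOfPred_isCompactOperator (𝕜₁ := ℂ) (𝕜₂ := ℂ) (σ₁₂ := RingHom.id ℂ)).preimage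
      opCLM.continuous
  have : CompleteSpace C := hC.completeSpace_coe
  have hR : ∀ f g, rankOne f g ∈ C := isCompactOperator_op_rankOne
  have h0 : op (M - C.starProjection M) = 0 := by
    ext1 f
    refine ext_inner_left ℂ fun g => ?_
    rw [← inner_rankOne, zero_apply, inner_zero_right]
    exact C.sub_starProjection_mem_orthogonal M _ (hR g f)
  rw [op_sub, sub_eq_zero] at h0
  rw [h0]
  exact C.starProjection_apply_mem M

/-! ### The spectral truncation and its operator -/

/-- The span of the eigenspaces of `M` with eigenvalues of absolute value greater than `lam`. -/
def highSpan (M : Lp ℂ 2 (μ.prod μ)) (lam : ℝ) : Submodule ℂ (Lp ℂ 2 μ) :=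
  spectralSpan (op M) {z | lam < ‖z‖}

/-- Eigenvalues are real, only finitely many exceed `lam` in modulus, and each of these has a
finite-dimensional eigenspace. -/
theorem finiteDimensional_highSpan (M : Lp ℂ 2 (μ.prod μ)) (hM : IsSelfAdjoint (op M)) {lam : ℝ}
    (hlam : 0 < lam) : FiniteDimensional ℂ (highSpan M lam) := by
  have hfin := finite_eigenvalues M hM hlam
  have hfd : ∀ τ : hfin.toFinset, FiniteDimensional ℂ (eigenspace M τ) := fun τ => by
    refine finiteDimensional_eigenspace M fun h0 => ?_
    have h := (hfin.mem_toFinset.mp τ.2).1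
    rw [h0, abs_zero] at h
    exact absurd h hlam.not_gt
  have hle : highSpan M lam ≤ ⨆ τ : hfin.toFinset, eigenspace M τ := by
    refine iSup_le fun z => ?_
    by_cases hz : Module.End.HasEigenvalue (op M : Module.End ℂ (Lp ℂ 2 μ)) z
    · have hre := hM.eq_ofReal_of_hasEigenvalue hz
      have hmem : (z : ℂ).re ∈ hfin.toFinset := by
        rw [hfin.mem_toFinset]
        refine ⟨?_, ?_⟩
        · rw [← Real.norm_eq_abs, ← Complex.norm_real, hre]
          exact z.2
        · rw [IsEigenvalue, hre]
          exact hz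
      refine le_trans ?_ (le_iSup (fun τ : hfin.toFinset => eigenspace M τ) ⟨_, hmem⟩)
      rw [eigenspace, hre]
    · rw [Module.End.hasEigenvalue_iff, not_not] at hz
      rw [hz]
      exact bot_le
  exact Submodule.finiteDimensional_of_le hle

theorem eigenspace_le_highSpan (M : Lp ℂ 2 (μ.prod μ)) {lam τ : ℝ} (hτ : lam < |τ|) :
    eigenspace M τ ≤ highSpan M lam :=
  eigenspace_le_spectralSpan (op M) (by simpa using hτ)

/-- If `τ` is not an eigenvalue, its eigenspace is zero and `projKernel` is an empty sum, so the
infinite sum has finite support. -/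
theorem trunc_eq_sum (M : Lp ℂ 2 (μ.prod μ)) (hM : IsSelfAdjoint (op M)) {lam : ℝ}
    (hlam : 0 < lam) : trunc M lam = ∑ τ ∈ (finite_eigenvalues M hM hlam).toFinset,
      (τ : ℂ) • projKernel (eigenspace M τ) := by
  refine (tsum_subtype {τ : ℝ | lam < |τ|}
    fun τ => (τ : ℂ) • projKernel (eigenspace M τ)).trans ?_
  rw [tsum_eq_sum (s := (finite_eigenvalues M hM hlam).toFinset)]
  · refine Finset.sum_congr rfl fun τ hτ => Set.indicator_of_mem ?_ _
    exact ((finite_eigenvalues M hM hlam).mem_toFinset.mp hτ).1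
  · intro τ hτ
    rw [Set.Finite.mem_toFinset] at hτ
    by_cases h : τ ∈ {τ : ℝ | lam < |τ|}
    · have hbot : eigenspace M τ = ⊥ := by
        by_contra hne
        exact hτ ⟨h, hne⟩
      rw [Set.indicator_of_mem h, hbot, projKernel,
        dif_pos (inferInstance : FiniteDimensional ℂ (⊥ : Submodule ℂ (Lp ℂ 2 μ))),
        Finset.sum_eq_zero, smul_zero]
      intro j
      exact (Fin.cast (finrank_bot ℂ (Lp ℂ 2 μ)) j).elim0
    · exact Set.indicator_of_notMem h _

theorem projKernel_mem_tensorSpan (W : Submodule ℂ (Lp ℂ 2 μ)) :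
    projKernel W ∈ tensorSpan W := by
  rw [projKernel]
  split_ifs with h
  · exact Submodule.sum_mem _ fun j _ => Submodule.subset_span
      ⟨_, (stdOrthonormalBasis ℂ W j).2, _, (stdOrthonormalBasis ℂ W j).2, rfl⟩
  · exact Submodule.zero_mem _

theorem trunc_mem_tensorSpan (M : Lp ℂ 2 (μ.prod μ)) (hM : IsSelfAdjoint (op M)) {lam : ℝ}
    (hlam : 0 < lam) : trunc M lam ∈ tensorSpan (highSpan M lam) := by
  rw [trunc_eq_sum M hM hlam]
  refine Submodule.sum_mem _ fun τ hτ => Submodule.smul_mem _ _ ?_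
  exact tensorSpan_mono (eigenspace_le_highSpan M ((Set.Finite.mem_toFinset _).mp hτ).1)
    (projKernel_mem_tensorSpan _)

/-- `starProjection` needs a finite-dimensionality instance for each eigenspace. Hence the
existential `hfd` and the sum over `attach`, which supplies the membership proofs. -/
theorem op_trunc_apply (M : Lp ℂ 2 (μ.prod μ)) (hM : IsSelfAdjoint (op M)) {lam : ℝ}
    (hlam : 0 < lam) (f : Lp ℂ 2 μ) :
    ∃ hfd : ∀ τ ∈ (finite_eigenvalues M hM hlam).toFinset, FiniteDimensional ℂ (eigenspace M τ),
      op (trunc M lam) f = ∑ τ ∈ (finite_eigenvalues M hM hlam).toFinset.attach,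
        ((τ : ℝ) : ℂ) • (haveI := hfd τ τ.2; (eigenspace M τ).starProjection f) := by
  have hfd : ∀ τ ∈ (finite_eigenvalues M hM hlam).toFinset,
      FiniteDimensional ℂ (eigenspace M τ) := fun τ hτ => by
    refine finiteDimensional_eigenspace M fun h0 => ?_
    have h := ((finite_eigenvalues M hM hlam).mem_toFinset.mp hτ).1
    rw [h0, abs_zero] at h
    exact absurd h hlam.not_gt
  refine ⟨hfd, ?_⟩
  rw [trunc_eq_sum M hM hlam, op_sum, sum_apply, ← Finset.sum_attach]
  refine Finset.sum_congr rfl fun τ _ => ?_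
  have := hfd τ τ.2
  rw [op_smul, op_projKernel, smul_apply]

/-- Both sides vanish on the complement of `highSpan M lam`. On an eigenvector inside it,
orthogonality of eigenspaces leaves a single term of the sum. -/
theorem op_trunc (M : Lp ℂ 2 (μ.prod μ)) (hM : IsSelfAdjoint (op M)) {lam : ℝ}
    (hlam : 0 < lam) [(highSpan M lam).HasOrthogonalProjection] :
    op (trunc M lam) = op M * (highSpan M lam).starProjection := by
  have hsym := ContinuousLinearMap.isSelfAdjoint_iff_isSymmetric.mp hM
  have horth : ∀ g ∈ (highSpan M lam)ᗮ, op (trunc M lam) g = 0 := by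
    intro g hg
    obtain ⟨hfd, h⟩ := op_trunc_apply M hM hlam g
    rw [h]
    refine Finset.sum_eq_zero fun τ _ => ?_
    have := hfd τ τ.2
    have hle := eigenspace_le_highSpan M ((Set.Finite.mem_toFinset _).mp τ.2).1
    rw [(Submodule.starProjection_apply_eq_zero_iff _).mpr (Submodule.orthogonal_le hle hg),
      smul_zero]
  have hhigh : ∀ f ∈ highSpan M lam, op (trunc M lam) f = op M f := by
    intro f hf
    refine Submodule.iSup_induction _ (motive := fun f => op (trunc M lam) f = op M f) hf
      ?_ (by simp) fun f g hf hg => by rw [map_add, map_add, hf, hg]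
    intro z f hf
    by_cases hf0 : f = 0
    · simp [hf0]
    have hz := Module.End.hasEigenvalue_of_hasEigenvector ⟨hf, hf0⟩
    have hre := hM.eq_ofReal_of_hasEigenvalue hz
    have hmem : (z : ℂ).re ∈ (finite_eigenvalues M hM hlam).toFinset := by
      rw [Set.Finite.mem_toFinset]
      refine ⟨?_, ?_⟩
      · rw [← Real.norm_eq_abs, ← Complex.norm_real, hre]
        exact z.2
      · rw [IsEigenvalue, hre]
        exact hz
    obtain ⟨hfd, h⟩ := op_trunc_apply M hM hlam f
    rw [h, Finset.sum_eq_single ⟨_, hmem⟩]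
    · have := hfd _ hmem
      have hf' : f ∈ eigenspace M (z : ℂ).re := by
        rw [eigenspace, hre]
        exact hf
      rw [Submodule.starProjection_eq_self_iff.mpr hf', op_eigenspace hf']
    · intro τ _ hne
      have := hfd τ τ.2
      have hne' : ((τ : ℝ) : ℂ) ≠ z := fun h => hne (Subtype.ext (congrArg Complex.re h))
      rw [(Submodule.starProjection_apply_eq_zero_iff _).mpr, smul_zero]
      exact hsym.orthogonalFamily_eigenspaces.isOrtho hne'.symm hf
    · exact fun h => absurd (Finset.mem_attach _ _) h
  ext1 f
  have hsplit : f = (highSpan M lam).starProjection f +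
    (f - (highSpan M lam).starProjection f) := by rw [add_sub_cancel]
  conv_lhs => rw [hsplit, map_add, horth _ (Submodule.sub_starProjection_mem_orthogonal f),
    add_zero, hhigh _ (Submodule.starProjection_apply_mem _ f)]
  rfl

theorem le_norm_op_of_mem_highSpan {M : Lp ℂ 2 (μ.prod μ)} (hM : IsSelfAdjoint (op M)) {lam : ℝ}
    (hlam : 0 ≤ lam) {f : Lp ℂ 2 μ} (hf : f ∈ highSpan M lam) : lam * ‖f‖ ≤ ‖op M f‖ :=
  le_norm_apply_of_mem_spectralSpan (ContinuousLinearMap.isSelfAdjoint_iff_isSymmetric.mp hM) hlam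
    (fun _ hz => le_of_lt hz) hf

theorem norm_op_le_of_mem_orthogonal_highSpan {M : Lp ℂ 2 (μ.prod μ)} (hM : IsSelfAdjoint (op M))
    {lam : ℝ} (hlam : 0 < lam) {g : Lp ℂ 2 μ} (hg : g ∈ (highSpan M lam)ᗮ) :
    ‖op M g‖ ≤ lam * ‖g‖ := by
  have : FiniteDimensional ℂ (spectralSpan (op M) {z | lam < ‖z‖}) :=
    finiteDimensional_highSpan M hM hlam
  exact norm_apply_le_of_mem_orthogonal_spectralSpan (S := {z | lam < ‖z‖}) hM
    (isCompactOperator_op M) hlam.le (fun _ hz => not_lt.mp hz) hg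

theorem op_mem_highSpan (M : Lp ℂ 2 (μ.prod μ)) (lam : ℝ) :
    ∀ f ∈ highSpan M lam, op M f ∈ highSpan M lam :=
  fun _ hf => apply_mem_spectralSpan _ _ hf

/-- `op M` maps `highSpan M lam` onto itself, being bounded below there by `lam > 0`, so that
subspace is the whole range of the truncation. -/
theorem rank_trunc (M : Lp ℂ 2 (μ.prod μ)) (hM : IsSelfAdjoint (op M)) {lam : ℝ}
    (hlam : 0 < lam) : rank (trunc M lam) = Module.finrank ℂ (highSpan M lam) := by
  have := finiteDimensional_highSpan M hM hlam
  have hr : LinearMap.range (op (trunc M lam) : Lp ℂ 2 μ →ₗ[ℂ] Lp ℂ 2 μ) = highSpan M lam := by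
    rw [op_trunc M hM hlam]
    apply le_antisymm
    · rintro _ ⟨f, rfl⟩
      exact op_mem_highSpan M lam _ (Submodule.starProjection_apply_mem _ f)
    · intro f hf
      obtain ⟨h, hh, rfl⟩ := exists_apply_eq_of_invariant (op_mem_highSpan M lam) hlam
        (fun f hf => le_norm_op_of_mem_highSpan hM hlam.le hf) hf
      refine ⟨h, ?_⟩
      change op M ((highSpan M lam).starProjection h) = op M h
      rw [Submodule.starProjection_eq_self_iff.mpr hh]
  rw [rank, hr, ← Module.finrank_eq_rank]
  simp

/-! ### Spectral gap and convergence of truncations -/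

/-- If `± lam` are not eigenvalues, then there is a gap in the spectrum around `± lam`. -/
theorem exists_spectral_gap (M : Lp ℂ 2 (μ.prod μ)) (hM : IsSelfAdjoint (op M)) {lam : ℝ}
    (hlam : 0 < lam) (hpos : ¬ IsEigenvalue M lam) (hneg : ¬ IsEigenvalue M (-lam)) :
    ∃ δ : ℝ, 0 < δ ∧ δ < lam ∧ (∀ f ∈ highSpan M lam, (lam + δ) * ‖f‖ ≤ ‖op M f‖) ∧
      ∀ g ∈ (highSpan M lam)ᗮ, ‖op M g‖ ≤ (lam - δ) * ‖g‖ := by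
  -- Only finitely many eigenvalues exceed `lam / 2` in modulus and none has modulus `lam`, so every
  -- small `δ` is below all their distances to `lam`. With `δ < lam / 2`, the window around `lam`
  -- stays in the range covered.
  have hev : ∀ᶠ δ : ℝ in 𝓝[>] 0, 0 < δ ∧ δ < lam / 2 ∧
      ∀ τ ∈ {τ : ℝ | lam / 2 < |τ| ∧ IsEigenvalue M τ}, δ < |(|τ| - lam)| := by
    refine (eventually_mem_nhdsWithin.mono fun _ h => h).and (Eventually.and ?_ ?_)
    · exact (eventually_lt_nhds (half_pos hlam)).filter_mono nhdsWithin_le_nhds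
    · rw [eventually_all_finite (finite_eigenvalues M hM (half_pos hlam))]
      intro τ hτ
      refine (eventually_lt_nhds ?_).filter_mono nhdsWithin_le_nhds
      rw [abs_pos, sub_ne_zero]
      intro h
      rcases (abs_eq hlam.le).mp h with rfl | rfl
      · exact hpos hτ.2
      · exact hneg hτ.2
  obtain ⟨δ, hδ, hδlam, hgap⟩ := hev.exists
  have hdich : ∀ z, Module.End.HasEigenvalue (op M : Module.End ℂ (Lp ℂ 2 μ)) z →
      lam - δ < ‖z‖ → lam + δ < ‖z‖ ∨ ‖z‖ < lam - δ := by
    intro z hz hlt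
    have hre := hM.eq_ofReal_of_hasEigenvalue hz
    have hn : |z.re| = ‖z‖ := by rw [← Real.norm_eq_abs, ← Complex.norm_real, hre]
    have h := hgap z.re ⟨by rw [hn]; linarith, by rw [IsEigenvalue, hre]; exact hz⟩
    rw [hn, lt_abs] at h
    rcases h with h | h
    · exact Or.inl (by linarith)
    · exact Or.inr (by linarith)
  -- No eigenvalue has modulus within `δ` of `lam`, so raising the threshold to `lam + δ` or
  -- lowering it to `lam - δ` does not change the span.
  have h1 : highSpan M lam ≤ highSpan M (lam + δ) := by
    refine spectralSpan_mono_of_hasEigenvalue _ fun z (hz : lam < ‖z‖) he => ?_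
    rcases hdich z he (by linarith) with h | h
    · exact h
    · exact absurd h (by linarith)
  have h2 : highSpan M (lam - δ) ≤ highSpan M lam := by
    refine spectralSpan_mono_of_hasEigenvalue _ fun z (hz : lam - δ < ‖z‖) he => ?_
    rcases hdich z he hz with h | h
    · exact show lam < ‖z‖ by linarith
    · exact absurd h hz.not_gt
  exact ⟨δ, hδ, by linarith, fun f hf => le_norm_op_of_mem_highSpan hM (by linarith) (h1 hf),
    fun g hg => norm_op_le_of_mem_orthogonal_highSpan hM (by linarith)
      (Submodule.orthogonal_le h2 hg)⟩

/-- If the operators of self-adjoint kernels converge in operator norm, then so do, in `L²`, their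
spectral truncations at a level avoiding the spectrum of the limit. -/
theorem tendsto_trunc_of_tendsto_op {M : ℕ → Lp ℂ 2 (μ.prod μ)} {L : Lp ℂ 2 (μ.prod μ)}
    (hM : ∀ i, IsSelfAdjoint (op (M i))) (hL : IsSelfAdjoint (op L))
    (hlim : Tendsto (fun i => op (M i)) atTop (𝓝 (op L))) {lam : ℝ} (hlam : 0 < lam)
    (hpos : ¬ IsEigenvalue L lam) (hneg : ¬ IsEigenvalue L (-lam)) :
    Tendsto (fun i => rank (trunc (M i) lam)) atTop (𝓝 (rank (trunc L lam))) ∧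
      Tendsto (fun i => ‖trunc (M i) lam - trunc L lam‖) atTop (𝓝 0) := by
  obtain ⟨δ, hδ, hδlam, hlow, hhigh⟩ := exists_spectral_gap L hL hlam hpos hneg
  have hfdL := finiteDimensional_highSpan L hL hlam
  have hfd := fun i => finiteDimensional_highSpan (M i) (hM i) hlam
  have hnorm : Tendsto (fun i => ‖op (M i) - op L‖) atTop (𝓝 0) :=
    tendsto_iff_norm_sub_tendsto_zero.mp hlim
  have hdiv : Tendsto (fun i => ‖op (M i) - op L‖ / δ) atTop (𝓝 0) := by
    simpa using hnorm.div_const δ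
  -- Here `a = lam` comes from `M i` and `b = lam - δ` from the gap of `L`; no gap for `M i` is
  -- needed.
  have hML : ∀ i, ‖(1 - (highSpan L lam).starProjection) *
      (highSpan (M i) lam).starProjection‖ ≤ ‖op (M i) - op L‖ / δ := fun i => by
    have h := norm_compl_starProjection_comp_le hL (op_mem_highSpan (M i) lam)
      (op_mem_highSpan L lam) (sub_nonneg.mpr hδlam.le) (by linarith)
      (fun f hf => le_norm_op_of_mem_highSpan (hM i) hlam.le hf) hhigh
    rwa [sub_sub_cancel] at h
  -- With the roles exchanged, `a = lam + δ` comes from the gap of `L` and `b = lam` from `M i`.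
  have hLM : ∀ i, ‖(1 - (highSpan (M i) lam).starProjection) *
      (highSpan L lam).starProjection‖ ≤ ‖op (M i) - op L‖ / δ := fun i => by
    have h := norm_compl_starProjection_comp_le (hM i) (op_mem_highSpan L lam)
      (op_mem_highSpan (M i) lam) hlam.le (by linarith) hlow
      (fun g hg => norm_op_le_of_mem_orthogonal_highSpan (hM i) hlam hg)
    rwa [add_sub_cancel_left, norm_sub_rev] at h
  have hrank : ∀ᶠ i in atTop,
      Module.finrank ℂ (highSpan (M i) lam) = Module.finrank ℂ (highSpan L lam) := by
    filter_upwards [hdiv.eventually_lt_const one_pos] with i hi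
    exact le_antisymm
      (finrank_le_of_norm_compl_starProjection_lt_one ((hML i).trans_lt hi))
      (finrank_le_of_norm_compl_starProjection_lt_one ((hLM i).trans_lt hi))
  have hP : Tendsto (fun i => (highSpan (M i) lam).starProjection) atTop
      (𝓝 (highSpan L lam).starProjection) := by
    rw [tendsto_iff_norm_sub_tendsto_zero]
    refine squeeze_zero (fun _ => norm_nonneg _)
      (fun i => norm_starProjection_sub_le.trans (add_le_add (hML i) (hLM i))) ?_
    simpa using hdiv.add hdiv
  have hop : Tendsto (fun i => ‖op (trunc (M i) lam - trunc L lam)‖) atTop (𝓝 0) := by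
    simp_rw [op_sub, op_trunc L hL hlam, fun i => op_trunc (M i) (hM i) hlam]
    exact tendsto_iff_norm_sub_tendsto_zero.mp (hlim.mul hP)
  refine ⟨?_, ?_⟩
  · refine tendsto_const_nhds.congr' ?_
    filter_upwards [hrank] with i hi
    rw [rank_trunc L hL hlam, rank_trunc (M i) (hM i) hlam, hi]
  -- The difference is supported on the sum of the two spectral subspaces, whose dimension is
  -- eventually at most twice that for `L`.
  · have hbound : ∀ᶠ i in atTop, ‖trunc (M i) lam - trunc L lam‖ ≤
        ((Module.finrank ℂ (highSpan L lam) + Module.finrank ℂ (highSpan L lam) : ℕ) : ℝ) *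
          ‖op (trunc (M i) lam - trunc L lam)‖ := by
      filter_upwards [hrank] with i hi
      have hmem : trunc (M i) lam - trunc L lam ∈
          tensorSpan (highSpan (M i) lam ⊔ highSpan L lam) :=
        Submodule.sub_mem _ (tensorSpan_mono le_sup_left (trunc_mem_tensorSpan _ (hM i) hlam))
          (tensorSpan_mono le_sup_right (trunc_mem_tensorSpan _ hL hlam))
      refine (norm_le_finrank_mul_norm_op hmem).trans
        (mul_le_mul_of_nonneg_right ?_ (norm_nonneg _))
      have h := Submodule.finrank_add_le_finrank_add_finrank (highSpan (M i) lam) (highSpan L lam)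
      rw [hi] at h
      exact_mod_cast h
    refine squeeze_zero' (Eventually.of_forall fun _ => norm_nonneg _) hbound ?_
    simpa using hop.const_mul
      ((Module.finrank ℂ (highSpan L lam) + Module.finrank ℂ (highSpan L lam) : ℕ) : ℝ)

/-! ### Cut norm and operator norm -/

theorem enorm_inner_op_le_cutNorm (M : Lp ℂ 2 (μ.prod μ)) {k : ℝ} (hk : 0 < k)
    {f g : Lp ℂ 2 μ} (hf : eLpNorm f ∞ μ ≤ ENNReal.ofReal k)
    (hg : eLpNorm g ∞ μ ≤ ENNReal.ofReal k) :
    ‖inner ℂ f (op M g)‖ₑ ≤ ENNReal.ofReal (k ^ 2) * cutNorm M := by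
  have hscale : ∀ h : Lp ℂ 2 μ, eLpNorm h ∞ μ ≤ ENNReal.ofReal k →
      eLpNorm (((k : ℂ)⁻¹ • h : Lp ℂ 2 μ) : V → ℂ) ∞ μ ≤ 1 := fun h hh => by
    have hkn : ‖(k : ℂ)⁻¹‖ₑ = (ENNReal.ofReal k)⁻¹ := by
      rw [enorm_inv (by exact_mod_cast hk.ne'), ← ofReal_norm, Complex.norm_real,
        Real.norm_of_nonneg hk.le]
    rw [eLpNorm_congr_ae (Lp.coeFn_smul _ _), eLpNorm_const_smul, hkn]
    exact (mul_le_mul_right hh _).trans_eq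
      (ENNReal.inv_mul_cancel (by simpa using hk) ENNReal.ofReal_ne_top)
  have hle : ‖inner ℂ ((k : ℂ)⁻¹ • f) (op M ((k : ℂ)⁻¹ • g))‖ₑ ≤ cutNorm M :=
    le_iSup₂_of_le _ _ (le_iSup₂_of_le (hscale f hf) (hscale g hg) le_rfl)
  have heq : inner ℂ f (op M g) =
      ((k ^ 2 : ℝ) : ℂ) * inner ℂ ((k : ℂ)⁻¹ • f) (op M ((k : ℂ)⁻¹ • g)) := by
    have hk' : (k : ℂ) ≠ 0 := by exact_mod_cast hk.ne'
    rw [map_smul, inner_smul_left, inner_smul_right, map_inv₀, Complex.conj_ofReal]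
    push_cast
    field_simp
  rw [heq, enorm_mul, ← ofReal_norm (((k ^ 2 : ℝ) : ℂ)), Complex.norm_real,
    Real.norm_of_nonneg (sq_nonneg k)]
  exact mul_le_mul_right hle _

theorem cutNorm_sub_le (M N : Lp ℂ 2 (μ.prod μ)) : cutNorm (M - N) ≤ cutNorm M + cutNorm N := by
  refine iSup₂_le fun f g => iSup₂_le fun hf hg => ?_
  rw [op_sub, sub_apply, inner_sub_right]
  refine enorm_sub_le.trans (add_le_add ?_ ?_)
  · exact le_iSup₂_of_le f g (le_iSup₂_of_le hf hg le_rfl)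
  · exact le_iSup₂_of_le f g (le_iSup₂_of_le hf hg le_rfl)

/-- Serves for the truncation tails, which are unbounded but small in `L¹`. -/
theorem enorm_inner_op_le_eLpNorm_one (M : Lp ℂ 2 (μ.prod μ)) (f g : Lp ℂ 2 μ) :
    ‖inner ℂ f (op M g)‖ₑ ≤ eLpNorm M ∞ (μ.prod μ) * (eLpNorm f 1 μ * eLpNorm g 1 μ) := by
  have hm : Measurable fun z : V × V => ‖f z.1‖ₑ * ‖g z.2‖ₑ :=
    ((Lp.stronglyMeasurable f).measurable.enorm.comp measurable_fst).mul
      ((Lp.stronglyMeasurable g).measurable.enorm.comp measurable_snd)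
  rw [← inner_rankOne, L2.inner_def, eLpNorm_one_eq_lintegral_enorm,
    eLpNorm_one_eq_lintegral_enorm, ← lintegral_prod_mul
      (Lp.stronglyMeasurable f).measurable.enorm.aemeasurable
      (Lp.stronglyMeasurable g).measurable.enorm.aemeasurable,
    ← lintegral_const_mul _ hm]
  refine (enorm_integral_le_lintegral_enorm _).trans (lintegral_mono_ae ?_)
  filter_upwards [(memLp_tensor f g).coeFn_toLp, enorm_ae_le_eLpNormEssSup M (μ.prod μ)]
    with p hp hMp
  rw [rankOne, hp, RCLike.inner_apply, enorm_mul, RCLike.enorm_conj, enorm_mul,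
    RCLike.enorm_conj, eLpNorm_exponent_top]
  exact mul_le_mul_left hMp _

/-- Truncation of an `L²` function at height `k`. -/
theorem exists_add_eq_eLpNorm_top_le (f : Lp ℂ 2 μ) {k : ℝ} (hk : 0 < k) :
    ∃ f₁ f₂ : Lp ℂ 2 μ, f₁ + f₂ = f ∧ eLpNorm f₁ ∞ μ ≤ ENNReal.ofReal k ∧
      eLpNorm f₁ 1 μ ≤ eLpNorm f 2 μ ∧
      eLpNorm f₂ 1 μ ≤ (ENNReal.ofReal k)⁻¹ * eLpNorm f 2 μ ^ 2 := by
  let s : Set V := {x | ‖f x‖ ≤ k}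
  have hs : MeasurableSet s := (Lp.stronglyMeasurable f).norm.measurable measurableSet_Iic
  have h1 := (Lp.memLp f).indicator hs
  have h2 := (Lp.memLp f).indicator hs.compl
  refine ⟨h1.toLp, h2.toLp, ?_, ?_, ?_, ?_⟩
  · rw [← MemLp.toLp_add]
    conv_rhs => rw [← Lp.toLp_coeFn f (Lp.memLp f)]
    exact MemLp.toLp_congr _ _ (by rw [Set.indicator_self_add_compl])
  · rw [eLpNorm_congr_ae h1.coeFn_toLp, eLpNorm_exponent_top]
    refine eLpNormEssSup_le_of_ae_bound (Eventually.of_forall fun x => ?_)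
    by_cases hx : x ∈ s
    · rw [Set.indicator_of_mem hx]
      exact hx
    · rw [Set.indicator_of_notMem hx, norm_zero]
      exact hk.le
  · rw [eLpNorm_congr_ae h1.coeFn_toLp]
    exact (eLpNorm_le_eLpNorm_of_exponent_le one_le_two h1.1).trans (eLpNorm_indicator_le _)
  -- Where `|f| > k`, one has `|f| ≤ |f|² / k`.
  · rw [eLpNorm_congr_ae h2.coeFn_toLp, eLpNorm_one_eq_lintegral_enorm, eLpNorm_two_sq,
      ← lintegral_const_mul' _ _ (by simpa using hk)]
    refine lintegral_mono fun x => ?_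
    by_cases hx : x ∈ s
    · rw [Set.indicator_of_notMem (show x ∉ sᶜ from fun h => h hx), enorm_zero]
      exact zero_le
    · rw [Set.indicator_of_mem (show x ∈ sᶜ from hx), sq, ← mul_assoc]
      have hkx : ENNReal.ofReal k ≤ ‖f x‖ₑ := by
        rw [← ofReal_norm]
        exact ENNReal.ofReal_le_ofReal (not_le.mp hx).le
      calc ‖f x‖ₑ = (ENNReal.ofReal k)⁻¹ * ENNReal.ofReal k * ‖f x‖ₑ := by
            rw [ENNReal.inv_mul_cancel (by simpa using hk) ENNReal.ofReal_ne_top, one_mul]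
        _ ≤ _ := by gcongr

/-- The operator norm of a bounded kernel is controlled by its cut norm. -/
theorem enorm_op_le_cutNorm (M : Lp ℂ 2 (μ.prod μ)) {k : ℝ} (hk : 0 < k) :
    ‖op M‖ₑ ≤ ENNReal.ofReal (k ^ 2) * cutNorm M +
      2 * eLpNorm M ∞ (μ.prod μ) * (ENNReal.ofReal k)⁻¹ := by
  set C := eLpNorm M ∞ (μ.prod μ) with hC
  set B := ENNReal.ofReal (k ^ 2) * cutNorm M + 2 * C * (ENNReal.ofReal k)⁻¹ with hB
  have hball : ∀ f g : Lp ℂ 2 μ, ‖f‖ ≤ 1 → ‖g‖ ≤ 1 → ‖inner ℂ f (op M g)‖ₑ ≤ B := by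
    intro f g hf hg
    have hone : ∀ h : Lp ℂ 2 μ, ‖h‖ ≤ 1 → eLpNorm h 2 μ ≤ 1 := fun h hh => by
      rw [← Lp.enorm_def, ← ofReal_norm]
      exact ENNReal.ofReal_le_one.mpr hh
    obtain ⟨f₁, f₂, hff, hf₁, hf₁', hf₂⟩ := exists_add_eq_eLpNorm_top_le f hk
    obtain ⟨g₁, g₂, hgg, hg₁, -, hg₂⟩ := exists_add_eq_eLpNorm_top_le g hk
    have hsmall : ∀ {h h₂ : Lp ℂ 2 μ}, ‖h‖ ≤ 1 →
        eLpNorm h₂ 1 μ ≤ (ENNReal.ofReal k)⁻¹ * eLpNorm h 2 μ ^ 2 →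
        eLpNorm h₂ 1 μ ≤ (ENNReal.ofReal k)⁻¹ := fun {h h₂} hh hle =>
      hle.trans ((mul_le_mul_right (pow_le_one₀ zero_le (hone h hh)) _).trans_eq (mul_one _))
    have hg' : eLpNorm g 1 μ ≤ 1 :=
      (eLpNorm_le_eLpNorm_of_exponent_le one_le_two
        (Lp.stronglyMeasurable g).aestronglyMeasurable).trans (hone g hg)
    -- The first term is bounded by the cut norm with factor `k²`. Each of the other two pairs a
    -- tail of `L¹` norm at most `1/k` with a function of `L¹` norm at most `1`; together they give
    -- `2C/k`.
    have hsplit : inner ℂ f (op M g) =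
        inner ℂ f₁ (op M g₁) + (inner ℂ f₁ (op M g₂) + inner ℂ f₂ (op M g)) := by
      rw [← hff, inner_add_left, ← add_assoc, ← inner_add_right, ← map_add, hgg]
    rw [hsplit, hB, mul_assoc, two_mul]
    refine (enorm_add_le _ _).trans (add_le_add (enorm_inner_op_le_cutNorm M hk hf₁ hg₁)
      ((enorm_add_le _ _).trans (add_le_add ?_ ?_)))
    · refine (enorm_inner_op_le_eLpNorm_one M f₁ g₂).trans (mul_le_mul_right ?_ _)
      exact (mul_le_mul' (hf₁'.trans (hone f hf)) (hsmall hg hg₂)).trans_eq (one_mul _)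
    · refine (enorm_inner_op_le_eLpNorm_one M f₂ g).trans (mul_le_mul_right ?_ _)
      exact (mul_le_mul' (hsmall hf hf₂) hg').trans_eq (mul_one _)
  by_cases hBtop : B = ∞
  · rw [hBtop]
    exact le_top
  rw [← ENNReal.ofReal_toReal hBtop, ← ofReal_norm]
  refine ENNReal.ofReal_le_ofReal (ContinuousLinearMap.opNorm_le_of_unit_norm
    ENNReal.toReal_nonneg fun g hg => ?_)
  by_cases h0 : op M g = 0
  · rw [h0, norm_zero]
    exact ENNReal.toReal_nonneg
  have hn : ‖op M g‖ ≠ 0 := norm_ne_zero_iff.mpr h0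
  -- Testing against the normalised vector `Mg / ‖Mg‖` recovers `‖Mg‖`.
  have h := hball (((‖op M g‖⁻¹ : ℝ) : ℂ) • op M g) g
    (by rw [norm_smul, Complex.norm_real, norm_inv, norm_norm, inv_mul_cancel₀ hn]) hg.le
  rw [inner_smul_left, Complex.conj_ofReal, inner_self_eq_norm_sq_to_K, ← ofReal_norm] at h
  have heq : ‖((‖op M g‖⁻¹ : ℝ) : ℂ) * ((‖op M g‖ : ℂ)) ^ 2‖ = ‖op M g‖ := by
    rw [norm_mul, norm_pow, Complex.norm_real, Complex.norm_real, norm_inv, norm_norm]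
    field_simp
  rw [← ENNReal.ofReal_le_iff_le_toReal hBtop]
  refine le_trans (le_of_eq ?_) h
  exact congrArg ENNReal.ofReal heq.symm

/-- Indicator functions are bounded and their span is dense in `L²`. The cut norm sees only bounded
functions, and this identifies the operator limit from them. -/
theorem eq_zero_of_inner_bounded_eq_zero {T : Lp ℂ 2 μ →L[ℂ] Lp ℂ 2 μ}
    (h : ∀ f g : Lp ℂ 2 μ, eLpNorm f ∞ μ < ∞ → eLpNorm g ∞ μ < ∞ → inner ℂ f (T g) = 0) :
    T = 0 := by
  have hind : ∀ (c : ℂ) {s : Set V} (hs : MeasurableSet s) (hμs : μ s < ∞),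
      eLpNorm (Lp.simpleFunc.indicatorConst 2 hs hμs.ne c : Lp ℂ 2 μ) ∞ μ < ∞ := by
    intro c s hs hμs
    rw [Lp.simpleFunc.coe_indicatorConst, eLpNorm_congr_ae indicatorConstLp_coeFn]
    exact (eLpNorm_indicator_const_le c ∞).trans_lt (by simp)
  have h1 : ∀ f g : Lp ℂ 2 μ, eLpNorm f ∞ μ < ∞ → inner ℂ f (T g) = 0 := by
    intro f g hf
    refine Lp.induction ENNReal.ofNat_ne_top (motive := fun g => inner ℂ f (T g) = 0)
      (fun c s hs hμs => h f _ hf (hind c hs hμs)) ?_ ?_ g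
    · intro f' g' _ _ _ hf' hg'
      rw [map_add, inner_add_right, hf', hg', add_zero]
    · exact isClosed_eq (by fun_prop) continuous_const
  have h2 : ∀ f g : Lp ℂ 2 μ, inner ℂ f (T g) = 0 := by
    intro f g
    refine Lp.induction ENNReal.ofNat_ne_top (motive := fun f => inner ℂ f (T g) = 0)
      (fun c s hs hμs => h1 _ g (hind c hs hμs)) ?_ ?_ f
    · intro f' g' _ _ _ hf' hg'
      rw [inner_add_left, hf', hg', add_zero]
    · exact isClosed_eq (by fun_prop) continuous_const
  ext1 g
  exact ext_inner_left ℂ fun f => by rw [h2, zero_apply, inner_zero_right]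

/-- For uniformly bounded kernels, convergence in the cut norm implies convergence of the
operators in norm. -/
theorem tendsto_op_of_tendsto_cutNorm {M : ℕ → Lp ℂ 2 (μ.prod μ)} {L : Lp ℂ 2 (μ.prod μ)}
    (hbdd : ∀ i, eLpNorm (M i) ∞ (μ.prod μ) ≤ 1)
    (hcut : Tendsto (fun i => cutNorm (M i - L)) atTop (𝓝 0)) :
    Tendsto (fun i => op (M i)) atTop (𝓝 (op L)) := by
  -- `L` is not assumed bounded, so the operator bound cannot be applied to `M i - L`; the
  -- differences `M i - M j` are bounded by `2`.
  have hcauchy : CauchySeq fun i => op (M i) := by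
    rw [Metric.cauchySeq_iff]
    intro ε hε
    -- With sup norm at most `2`, the tail term is at most `2 · 2 / k = ε / 4`. The two cut-norm
    -- terms are at most `ε / 4` each, for a total of `3ε / 4 < ε`.
    let k : ℝ := 16 / ε
    have hk : 0 < k := by positivity
    have hlim : Tendsto (fun i => ENNReal.ofReal (k ^ 2) * cutNorm (M i - L)) atTop (𝓝 0) := by
      simpa using ENNReal.Tendsto.const_mul hcut (Or.inr ENNReal.ofReal_ne_top)
    obtain ⟨N, hN⟩ := eventually_atTop.mp
      (hlim.eventually_le_const (u := ENNReal.ofReal (ε / 4)) (by simpa using hε))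
    refine ⟨N, fun i hi j hj => ?_⟩
    have hCle : eLpNorm (M i - M j : Lp ℂ 2 (μ.prod μ)) ∞ (μ.prod μ) ≤ 2 := by
      rw [eLpNorm_congr_ae (Lp.coeFn_sub _ _)]
      refine (eLpNorm_sub_le (Lp.stronglyMeasurable _).aestronglyMeasurable
        (Lp.stronglyMeasurable _).aestronglyMeasurable le_top).trans
        ((add_le_add (hbdd i) (hbdd j)).trans_eq one_add_one_eq_two)
    have hcle : cutNorm (M i - M j) ≤ cutNorm (M i - L) + cutNorm (M j - L) := by
      rw [← sub_sub_sub_cancel_right (M i) (M j) L]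
      exact cutNorm_sub_le _ _
    have hle : ‖op (M i - M j)‖ₑ ≤ ENNReal.ofReal (ε / 4 + ε / 4 + ε / 4) := by
      refine (enorm_op_le_cutNorm (M i - M j) hk).trans ?_
      rw [ENNReal.ofReal_add (by positivity) (by positivity),
        ENNReal.ofReal_add (by positivity) (by positivity)]
      refine add_le_add ?_ ?_
      · refine (mul_le_mul_right hcle _).trans ?_
        rw [mul_add]
        exact add_le_add (hN i hi) (hN j hj)
      · refine (mul_le_mul_left (mul_le_mul_right hCle _) _).trans_eq ?_
        rw [← ENNReal.ofReal_inv_of_pos hk, show (2 * 2 : ℝ≥0∞) = ENNReal.ofReal 4 by norm_num,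
          ← ENNReal.ofReal_mul (by norm_num)]
        congr 1
        simp only [k]
        field_simp
        norm_num
    rw [← ofReal_norm, ENNReal.ofReal_le_ofReal_iff (by positivity), op_sub] at hle
    rw [dist_eq_norm]
    linarith
  obtain ⟨T, hT⟩ := cauchySeq_tendsto_of_complete hcauchy
  have hTL : T - op L = 0 := by
    refine eq_zero_of_inner_bounded_eq_zero fun f g hf hg => ?_
    have h1 : Tendsto (fun i => inner ℂ f (op (M i - L) g)) atTop
        (𝓝 (inner ℂ f ((T - op L) g))) := by
      simp_rw [op_sub, sub_apply]
      have hTg : Tendsto (fun i => op (M i) g) atTop (𝓝 (T g)) :=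
        ((ContinuousLinearMap.apply ℂ (Lp ℂ 2 μ) g).continuous.tendsto T).comp hT
      exact tendsto_const_nhds.inner (hTg.sub tendsto_const_nhds)
    -- A common bound for both sup norms; the summand `1` keeps it positive.
    let k : ℝ := (eLpNorm f ∞ μ).toReal + (eLpNorm g ∞ μ).toReal + 1
    have hk : 0 < k := by positivity
    have hfk : eLpNorm f ∞ μ ≤ ENNReal.ofReal k := by
      rw [ENNReal.le_ofReal_iff_toReal_le hf.ne hk.le]
      have : 0 ≤ (eLpNorm g ∞ μ).toReal := ENNReal.toReal_nonneg
      simp only [k]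
      linarith
    have hgk : eLpNorm g ∞ μ ≤ ENNReal.ofReal k := by
      rw [ENNReal.le_ofReal_iff_toReal_le hg.ne hk.le]
      have : 0 ≤ (eLpNorm f ∞ μ).toReal := ENNReal.toReal_nonneg
      simp only [k]
      linarith
    have hlim : Tendsto (fun i => ENNReal.ofReal (k ^ 2) * cutNorm (M i - L)) atTop (𝓝 0) := by
      simpa using ENNReal.Tendsto.const_mul hcut (Or.inr ENNReal.ofReal_ne_top)
    have h2 : Tendsto (fun i => ‖inner ℂ f (op (M i - L) g)‖ₑ) atTop (𝓝 0) :=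
      tendsto_of_tendsto_of_tendsto_of_le_of_le tendsto_const_nhds hlim (fun _ => zero_le)
        fun i => enorm_inner_op_le_cutNorm (M i - L) hk hfk hgk
    exact enorm_eq_zero.mp (tendsto_nhds_unique ((continuous_enorm.tendsto _).comp h1) h2)
  rwa [← sub_eq_zero.mp hTL]

end HSKernel

end

theorem mainTheorem4 {V : Type*} [MeasurableSpace V] (μ : Measure V) [IsProbabilityMeasure μ]
    [IsSeparable μ] (M : ℕ → Lp ℂ 2 (μ.prod μ)) (L : Lp ℂ 2 (μ.prod μ))
    (hself : ∀ i, IsSelfAdjoint (HSKernel.op (M i)))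
    (hbdd : ∀ i, eLpNorm (M i) ∞ (μ.prod μ) ≤ 1)
    (hcut : Tendsto (fun i => HSKernel.cutNorm (M i - L)) atTop (𝓝 0))
    (lam : ℝ) (hlam : 0 < lam)
    (hpos : ¬ HSKernel.IsEigenvalue L lam) (hneg : ¬ HSKernel.IsEigenvalue L (-lam)) :
    Tendsto (fun i => HSKernel.rank (HSKernel.trunc (M i) lam)) atTop
        (𝓝 (HSKernel.rank (HSKernel.trunc L lam))) ∧
      Tendsto (fun i => ‖HSKernel.trunc (M i) lam - HSKernel.trunc L lam‖) atTop (𝓝 0) := by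
  have hlim := HSKernel.tendsto_op_of_tendsto_cutNorm hbdd hcut
  -- Self-adjointness is a norm-closed condition, so it passes to the limit operator.
  have hL : IsSelfAdjoint (HSKernel.op L) :=
    (isClosed_eq continuous_star continuous_id).mem_of_tendsto hlim (Eventually.of_forall hself)
  exact HSKernel.tendsto_trunc_of_tendsto_op hself hL hlim hlam hpos hneg
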